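/- Let $n\ge 1$ and $N_1,\dots,N_n\ge 1$, and let $G$ be a finite simple graph with at least one edge on the vertex set $V=\{v_{i_1,\dots,i_n} : 1\le i_j\le N_j\}$ of size $N_1\cdots N_n$; its adjacency matrix $A(G)$ and degree matrix $D(G)$ are regarded as matrices on $\mathbb{C}^{N_1}\otimes\cdots\otimes\mathbb{C}^{N_n}$, the vertex $v_{i_1,\dots,i_n}$ corresponding to $e_{i_1}\otimes\cdots\otimes e_{i_n}$. For $1\le p\le n$ and a multi-index $I=(i_1,\dots,i_p)$, the layer $C_I$ of level $p$ is the set of vertices whose first $p$ indices are $i_1,\dots,i_p$, and $A_{I,J}$ denotes the block of $A(G)$ with rows in $C_I$ and columns in $C_J$, rows and columns being indexed by the remaining $n-p$ indices. Suppose that $G$ is partially symmetric, i.e. whenever $i_1\ne j_1$ and $(v_{i_1,i_2,\dots,i_n},v_{j_1,j_2,\dots,j_n})$ is an edge, $(v_{j_1,i_2,\dots,i_n},v_{i_1,j_2,\dots,j_n})$ is an edge as well, and that: (1) no edge joins two vertices of the same first-level layer $C_{i_1}$; (2) for every level $1\le p\le n-1$, any two nonzero blocks between distinct layers of level $p$ are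 equal: if $I\ne J$ and $K\ne L$ are multi-indices of length $p$, then $A_{I,J}=0$, or $A_{K,L}=0$, or $A_{I,J}=A_{K,L}$; (3) all vertices of the same first-level layer $C_{i_1}$ have the same degree. Let $Q(G)=D(G)+A(G)$. Then the density matrix $\rho_q(G)=Q(G)/\operatorname{tr}Q(G)$ is fully separable in $\mathbb{C}^{N_1}\otimes\cdots\otimes\mathbb{C}^{N_n}$, i.e. $\rho_q(G)=\sum_i q_i\,\rho_i^1\otimes\cdots\otimes\rho_i^n$ is a finite sum with $q_i\ge 0$, $\sum_i q_i=1$, and each $\rho_i^j$ a density matrix (positive semidefinite with trace $1$) on $\mathbb{C}^{N_j}$. -/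

import Mathlib

namespace GraphState

open scoped ComplexOrder

/-- Vertices `v_{i_1,…,i_n}` of a graph on `N_1 ⋯ N_n` vertices, labelled by multi-indices; these
also index the product basis of `H_1 ⊗ ⋯ ⊗ H_n` with `H_j = ℂ^{N_j}`. Indices start at `0`. -/
abbrev Vertex {n : ℕ} (N : Fin n → ℕ) : Type := ∀ j : Fin n, Fin (N j)

/-- Multi-indices `(i_1,…,i_p)`, which label the layers of level `p`. -/
abbrev Head {n : ℕ} (N : Fin n → ℕ) (p : ℕ) : Type := ∀ j : {j : Fin n // j.val < p}, Fin (N j)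

/-- The remaining indices `(i_{p+1},…,i_n)`, which label the vertices within a layer of level `p`. -/
abbrev Tail {n : ℕ} (N : Fin n → ℕ) (p : ℕ) : Type := ∀ j : {j : Fin n // ¬ j.val < p}, Fin (N j)

/-- The vertex with first indices `I` and remaining indices `x`. -/
def vertexOf {n : ℕ} {N : Fin n → ℕ} {p : ℕ} (I : Head N p) (x : Tail N p) : Vertex N :=
  fun j => if h : j.val < p then I ⟨j, h⟩ else x ⟨j, h⟩

/-- The layer `C_{i_1,…,i_p}` of level `p`. -/
def layer {n : ℕ} {N : Fin n → ℕ} {p : ℕ} (I : Head N p) : Set (Vertex N) :=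
  {v | ∀ j : {j : Fin n // j.val < p}, v j = I j}

/-- There is no edge between vertices of the layers `C_I` and `C_J`. -/
def NoEdgeBetween {n : ℕ} {N : Fin n → ℕ} (G : SimpleGraph (Vertex N)) {p : ℕ}
    (I J : Head N p) : Prop :=
  ∀ u ∈ layer I, ∀ v ∈ layer J, ¬ G.Adj u v

/-- The block `A_{I,J}` of the adjacency matrix, for layers `C_I`, `C_J` of level `p`. -/
def adjBlock {n : ℕ} {N : Fin n → ℕ} (G : SimpleGraph (Vertex N)) [DecidableRel G.Adj] {p : ℕ}
    (I J : Head N p) : Matrix (Tail N p) (Tail N p) ℂ :=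
  (G.adjMatrix ℂ).submatrix (vertexOf I) (vertexOf J)

/-- Partial symmetry: swapping the first indices of the two ends of an edge gives an edge. -/
def IsPartiallySymmetric {n : ℕ} [NeZero n] {N : Fin n → ℕ} (G : SimpleGraph (Vertex N)) : Prop :=
  ∀ u v : Vertex N, u 0 ≠ v 0 → G.Adj u v →
    G.Adj (Function.update u 0 (v 0)) (Function.update v 0 (u 0))

/-- At every level `p = 1, …, n - 1`, any two nonzero blocks of the adjacency matrix between
distinct layers are equal. -/
def EqualInterlayerBlocks {n : ℕ} {N : Fin n → ℕ} (G : SimpleGraph (Vertex N))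
    [DecidableRel G.Adj] : Prop :=
  ∀ p : ℕ, 1 ≤ p → p < n → ∀ I J K L : Head N p, I ≠ J → K ≠ L →
    NoEdgeBetween G I J ∨ NoEdgeBetween G K L ∨ adjBlock G I J = adjBlock G K L

/-- `Q(G) = D(G) + A(G)`. -/
def signlessLaplacian {V : Type*} [Fintype V] [DecidableEq V] (G : SimpleGraph V)
    [DecidableRel G.Adj] : Matrix V V ℂ :=
  G.degMatrix ℂ + G.adjMatrix ℂ

/-- `ρ_q(G) = Q(G) / tr Q(G)`; meaningful when `G` has an edge. -/
noncomputable def rhoQ {V : Type*} [Fintype V] [DecidableEq V] (G : SimpleGraph V)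
    [DecidableRel G.Adj] : Matrix V V ℂ :=
  (signlessLaplacian G).trace⁻¹ • signlessLaplacian G

/-- Density matrices: (Hermitian) positive semidefinite with unit trace. -/
def IsDensityMatrix {V : Type*} [Fintype V] (ρ : Matrix V V ℂ) : Prop :=
  ρ.PosSemidef ∧ ρ.trace = 1

/-- The tensor product `σ_1 ⊗ ⋯ ⊗ σ_n` in the product basis. -/
def tensorProd {n : ℕ} {N : Fin n → ℕ} (σ : ∀ j : Fin n, Matrix (Fin (N j)) (Fin (N j)) ℂ) :
    Matrix (Vertex N) (Vertex N) ℂ :=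
  Matrix.of fun u v => ∏ j, σ j (u j) (v j)

/-- Full separability: a finite convex combination of tensor products of density matrices. -/
def IsFullySeparable {n : ℕ} {N : Fin n → ℕ} (ρ : Matrix (Vertex N) (Vertex N) ℂ) : Prop :=
  ∃ (m : ℕ) (q : Fin m → ℝ) (σ : Fin m → ∀ j : Fin n, Matrix (Fin (N j)) (Fin (N j)) ℂ),
    (∀ i, 0 ≤ q i) ∧ ∑ i, q i = 1 ∧ (∀ i j, IsDensityMatrix (σ i j)) ∧
      ρ = ∑ i, (q i : ℂ) • tensorProd (σ i)

end GraphState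

namespace GraphState

open scoped ComplexOrder

/-! ### Cones of product operators -/

/-! Equality of the nonzero blocks at every level lets the head of one edge be glued to the tail of
another, so adjacency is the product of its coordinate relations (`adj_iff_forall_coordRel`). Hence
`A = ⊗ B_j` and `D = ⊗ D_j`, with `D_j` the row sums of `B_j`. Averaging over signs
(`tensorProd_add_tensorProd`) gives `Q = 2⁻ⁿ ∑_s (1 + ∏ s_j) ⊗ (D_j + s_j B_j)`. The weights are
nonnegative, and each factor is positive semidefinite as a signed Laplacian, so normalising the
factors gives a separable decomposition. -/

theorem trace_tensorProd {n : ℕ} {N : Fin n → ℕ}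
    (σ : ∀ j : Fin n, Matrix (Fin (N j)) (Fin (N j)) ℂ) :
    (tensorProd σ).trace = ∏ j, (σ j).trace := by
  simp only [Matrix.trace, Matrix.diag_apply, tensorProd, Matrix.of_apply]
  exact (Fintype.prod_sum fun j x => σ j x x).symm

theorem tensorProd_smul {n : ℕ} {N : Fin n → ℕ} (c : Fin n → ℂ)
    (σ : ∀ j : Fin n, Matrix (Fin (N j)) (Fin (N j)) ℂ) :
    tensorProd (fun j => c j • σ j) = (∏ j, c j) • tensorProd σ := by
  ext u v
  simp [tensorProd, Finset.prod_mul_distrib]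

theorem exists_isDensityMatrix {V : Type*} [Fintype V] [Nonempty V] :
    ∃ σ : Matrix V V ℂ, IsDensityMatrix σ := by
  classical
  obtain ⟨a⟩ := ‹Nonempty V›
  refine ⟨Matrix.vecMulVec (Pi.single a 1) (star (Pi.single a 1)),
    Matrix.posSemidef_vecMulVec_self_star _, ?_⟩
  rw [Matrix.trace_vecMulVec]
  simp

/-- Every positive semidefinite matrix is a nonnegative multiple of a density matrix. -/
theorem exists_eq_smul_isDensityMatrix {V : Type*} [Fintype V] [Nonempty V]
    {τ : Matrix V V ℂ} (hτ : τ.PosSemidef) :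
    ∃ (t : ℝ) (σ : Matrix V V ℂ), 0 ≤ t ∧ IsDensityMatrix σ ∧ τ = (t : ℂ) • σ := by
  have h0 := hτ.trace_nonneg
  obtain ⟨t, ht⟩ : ∃ t : ℝ, (t : ℂ) = τ.trace := ⟨τ.trace.re, by
    rw [Complex.nonneg_iff] at h0
    exact Complex.ext (by simp) (by simpa using h0.2)⟩
  rw [← ht] at h0
  have h0' : 0 ≤ t := by exact_mod_cast h0
  by_cases h : t = 0
  -- Trace zero forces `τ = 0`, so any density matrix serves.
  · obtain ⟨σ, hσ⟩ := exists_isDensityMatrix (V := V)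
    refine ⟨0, σ, le_rfl, hσ, ?_⟩
    rw [h] at ht
    simpa using hτ.trace_eq_zero_iff.1 (by simpa using ht.symm)
  · have hc : (t : ℂ) ≠ 0 := by exact_mod_cast h
    refine ⟨t, (t : ℂ)⁻¹ • τ, h0', ⟨hτ.smul ?_, ?_⟩, ?_⟩
    · rw [← Complex.ofReal_inv]
      exact_mod_cast inv_nonneg.2 h0'
    · rw [Matrix.trace_smul, ← ht, smul_eq_mul, inv_mul_cancel₀ hc]
    · rw [smul_smul, mul_inv_cancel₀ hc, one_smul]

/-- A unit-trace nonnegative combination of tensor products of positive semidefinite matrices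
is fully separable. -/
theorem isFullySeparable_of_eq_sum {n : ℕ} {N : Fin n → ℕ} [∀ j, Nonempty (Fin (N j))]
    {ι : Type*} [Fintype ι] {ρ : Matrix (Vertex N) (Vertex N) ℂ} (htr : ρ.trace = 1)
    (c : ι → ℝ) (τ : ι → ∀ j : Fin n, Matrix (Fin (N j)) (Fin (N j)) ℂ)
    (hc : ∀ i, 0 ≤ c i) (hτ : ∀ i j, (τ i j).PosSemidef)
    (hρ : ρ = ∑ i, (c i : ℂ) • tensorProd (τ i)) :
    IsFullySeparable ρ := by
  choose t σ ht hσ hτσ using fun i j => exists_eq_smul_isDensityMatrix (hτ i j)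
  have hρ' : ρ = ∑ i, ((c i * ∏ j, t i j : ℝ) : ℂ) • tensorProd (σ i) := by
    rw [hρ]
    refine Finset.sum_congr rfl fun i _ => ?_
    rw [show τ i = fun j => (t i j : ℂ) • σ i j from funext (hτσ i), tensorProd_smul, smul_smul]
    push_cast
    rfl
  have hsum : ∑ i, c i * ∏ j, t i j = 1 := by
    have h := htr
    rw [hρ', Matrix.trace_sum] at h
    simp only [Matrix.trace_smul, trace_tensorProd, (hσ _ _).2, Finset.prod_const_one,
      smul_eq_mul, mul_one] at h
    exact_mod_cast h
  let e := Fintype.equivFin ι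
  refine ⟨Fintype.card ι, fun k => c (e.symm k) * ∏ j, t (e.symm k) j, fun k => σ (e.symm k),
    fun k => mul_nonneg (hc _) (Finset.prod_nonneg fun j _ => ht _ _), ?_, fun k j => hσ _ _, ?_⟩
  · rw [← hsum]
    exact e.symm.sum_comp fun i => c i * ∏ j, t i j
  · rw [hρ']
    exact (e.symm.sum_comp fun i => ((c i * ∏ j, t i j : ℝ) : ℂ) • tensorProd (σ i)).symm

/-! ### Signed Laplacians of symmetric relations -/

open Classical in
/-- The 0/1 matrix of a relation. -/
noncomputable def relMatrix {V : Type*} (r : V → V → Prop) : Matrix V V ℂ :=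
  Matrix.of fun x y => if r x y then 1 else 0

/-- The diagonal matrix of the row sums of a 0/1 matrix of a relation. -/
noncomputable def relDegMatrix {V : Type*} [Fintype V] [DecidableEq V] (r : V → V → Prop) :
    Matrix V V ℂ :=
  Matrix.diagonal fun x => ∑ y, relMatrix r x y

/-- The quadratic form is a sum of squares `|f x + s f y|²` over related pairs. Loops are allowed,
since coordinate relations may have them. -/
theorem posSemidef_relDegMatrix_add_smul {V : Type*} [Fintype V] [DecidableEq V]
    {r : V → V → Prop} (hr : ∀ x y, r x y → r y x) (s : ℤˣ) :
    (relDegMatrix r + ((s : ℤ) : ℂ) • relMatrix r).PosSemidef := by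
  have hsymm : ∀ x y, relMatrix r x y = relMatrix r y x := fun x y => by
    classical
    rw [relMatrix, Matrix.of_apply, Matrix.of_apply]
    exact if_congr ⟨hr x y, hr y x⟩ rfl rfl
  let w : V → V → V → ℂ := fun x y => Pi.single x 1 + ((s : ℤ) : ℂ) • Pi.single y 1
  have hs : ((s : ℤ) : ℂ) * ((s : ℤ) : ℂ) = 1 := by
    exact_mod_cast Int.units_coe_mul_self s
  -- The factor 1/2 is there because the sum runs over ordered pairs.
  have key : relDegMatrix r + ((s : ℤ) : ℂ) • relMatrix r =
      ∑ x, ∑ y, (relMatrix r x y / 2) • Matrix.vecMulVec (w x y) (star (w x y)) := by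
    have hw : ∀ x y a b, w x y a * star (w x y b) =
        (if a = x then if b = x then 1 else 0 else 0) +
        ((s : ℤ) : ℂ) * (if a = x then if b = y then 1 else 0 else 0) +
        ((s : ℤ) : ℂ) * (if b = x then if a = y then 1 else 0 else 0) +
        (if a = y then if b = y then 1 else 0 else 0) := by
      intro x y a b
      simp only [w, Pi.add_apply, Pi.smul_apply, Pi.single_apply, smul_eq_mul, star_add, star_mul',
        Complex.star_def, map_intCast, apply_ite (starRingEnd ℂ), map_one, map_zero]
      split_ifs <;> first | ring1 | linear_combination hs
    ext a b
    simp only [Matrix.sum_apply, Matrix.smul_apply, Matrix.vecMulVec_apply, Pi.star_apply, hw,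
      smul_eq_mul, mul_add, Finset.sum_add_distrib, Matrix.add_apply, mul_ite, mul_one, mul_zero,
      Finset.sum_ite_irrel, Finset.sum_const_zero, Finset.sum_ite_eq, Finset.mem_univ, if_true,
      relDegMatrix, Matrix.diagonal_apply]
    rw [hsymm b a]
    simp only [hsymm _ a, eq_comm (a := b), ← Finset.sum_div]
    split_ifs <;> ring
  rw [key]
  refine Matrix.posSemidef_sum _ fun x _ => Matrix.posSemidef_sum _ fun y _ =>
    (Matrix.posSemidef_vecMulVec_self_star _).smul ?_
  simp only [relMatrix, Matrix.of_apply]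
  split_ifs <;> simp

/-- Expansion of `⊗ D_j + ⊗ B_j` over sign patterns. -/
theorem tensorProd_add_tensorProd {n : ℕ} {N : Fin n → ℕ}
    (D B : ∀ j : Fin n, Matrix (Fin (N j)) (Fin (N j)) ℂ) :
    tensorProd D + tensorProd B = ∑ s : Fin n → ℤˣ,
      ((1 + ∏ j, ((s j : ℤ) : ℂ)) / 2 ^ n) •
        tensorProd (fun j => D j + ((s j : ℤ) : ℂ) • B j) := by
  ext u v
  simp only [Matrix.sum_apply, Matrix.smul_apply, Matrix.add_apply, tensorProd, Matrix.of_apply,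
    smul_eq_mul]
  have h1 := Fintype.prod_sum fun (j : Fin n) (s : ℤˣ) =>
    D j (u j) (v j) + ((s : ℤ) : ℂ) * B j (u j) (v j)
  have h2 := Fintype.prod_sum fun (j : Fin n) (s : ℤˣ) =>
    ((s : ℤ) : ℂ) * (D j (u j) (v j) + ((s : ℤ) : ℂ) * B j (u j) (v j))
  -- Summing over a sign isolates the `D` entry; weighting by the sign first isolates the `B` entry.
  have e1 : ∀ a b : ℂ, ∑ s : ℤˣ, (a + ((s : ℤ) : ℂ) * b) = 2 * a := fun a b => by
    rw [show (Finset.univ : Finset ℤˣ) = {1, -1} from rfl, Finset.sum_pair (by decide)]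
    push_cast
    ring
  have e2 : ∀ a b : ℂ, ∑ s : ℤˣ, ((s : ℤ) : ℂ) * (a + ((s : ℤ) : ℂ) * b) = 2 * b := fun a b => by
    rw [show (Finset.univ : Finset ℤˣ) = {1, -1} from rfl, Finset.sum_pair (by decide)]
    push_cast
    ring
  simp only [e1, e2, Finset.prod_mul_distrib, Finset.prod_const, Finset.card_univ,
    Fintype.card_fin] at h1 h2
  simp only [add_div, add_mul, Finset.sum_add_distrib, div_mul_eq_mul_div, one_mul,
    ← Finset.sum_div]
  rw [← h1, ← h2]
  field_simp

/-! ### Product structure of the adjacency relation -/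

/-- The relation on the `j`-th indices of the ends of edges. -/
def coordRel {n : ℕ} {N : Fin n → ℕ} (G : SimpleGraph (Vertex N)) (j : Fin n)
    (x y : Fin (N j)) : Prop :=
  ∃ u v, G.Adj u v ∧ u j = x ∧ v j = y

theorem coordRel_symmetric {n : ℕ} {N : Fin n → ℕ} (G : SimpleGraph (Vertex N)) (j : Fin n) :
    ∀ x y, coordRel G j x y → coordRel G j y x := by
  rintro x y ⟨u, v, h, hu, hv⟩
  exact ⟨v, u, h.symm, hv, hu⟩

/-- Joining the first `p` indices of one edge with the remaining indices of another one
gives an edge. -/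
theorem adj_vertexOf {n : ℕ} [NeZero n] {N : Fin n → ℕ} {G : SimpleGraph (Vertex N)}
    [DecidableRel G.Adj] (hlayer : ∀ u v : Vertex N, u 0 = v 0 → ¬ G.Adj u v)
    (hblock : EqualInterlayerBlocks G) {p : ℕ} (hp : 1 ≤ p) (hpn : p < n)
    {u v u' v' : Vertex N} (h : G.Adj u v) (h' : G.Adj u' v') :
    G.Adj (vertexOf (p := p) (fun j => u j) (fun j => u' j))
      (vertexOf (p := p) (fun j => v j) (fun j => v' j)) := by
  -- As `p ≥ 1`, the head contains the first index, on which the ends of an edge differ.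
  have hdist : ∀ {a b : Vertex N}, G.Adj a b →
      (fun j => a j : Head N p) ≠ (fun j => b j : Head N p) := fun {a b} hab heq =>
    hlayer a b (congrFun heq ⟨0, by simp; omega⟩) hab
  have hself : ∀ a : Vertex N, vertexOf (p := p) (fun j => a j) (fun j => a j) = a := fun a => by
    funext j
    simp [vertexOf]
  rcases hblock p hp hpn _ _ _ _ (hdist h) (hdist h') with h0 | h0 | h0
  · exact absurd h (h0 u (fun _ => rfl) v (fun _ => rfl))
  · exact absurd h' (h0 u' (fun _ => rfl) v' (fun _ => rfl))
  · have h1 := congrFun (congrFun h0 (fun j => u' j)) (fun j => v' j)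
    simp only [adjBlock, Matrix.submatrix_apply, hself, SimpleGraph.adjMatrix_apply, h',
      if_true] at h1
    by_contra hno
    simp [hno] at h1

/-- The adjacency relation is the product of its coordinate relations. -/
theorem adj_iff_forall_coordRel {n : ℕ} [NeZero n] {N : Fin n → ℕ} {G : SimpleGraph (Vertex N)}
    [DecidableRel G.Adj] (hlayer : ∀ u v : Vertex N, u 0 = v 0 → ¬ G.Adj u v)
    (hblock : EqualInterlayerBlocks G) (u v : Vertex N) :
    G.Adj u v ↔ ∀ j, coordRel G j (u j) (v j) := by
  refine ⟨fun h j => ⟨u, v, h, rfl, rfl⟩, fun h => ?_⟩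
  -- Induction on the length of agreement: the head of the edge found so far is glued to the tail of
  -- an edge witnessing coordinate `p` (counted from 0).
  have key : ∀ p : ℕ, 1 ≤ p → p ≤ n →
      ∃ a b, G.Adj a b ∧ ∀ j : Fin n, j.val < p → a j = u j ∧ b j = v j := by
    intro p hp
    induction p, hp using Nat.le_induction with
    | base =>
      intro _
      obtain ⟨a, b, hab, ha, hb⟩ := h 0
      refine ⟨a, b, hab, fun j hj => ?_⟩
      obtain rfl : j = 0 := Fin.ext (by simpa using hj)
      exact ⟨ha, hb⟩
    | succ p hp ih =>
      intro hpn
      obtain ⟨a, b, hab, hagree⟩ := ih (by omega)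
      obtain ⟨a', b', hab', ha', hb'⟩ := h ⟨p, hpn⟩
      refine ⟨_, _, adj_vertexOf hlayer hblock hp hpn hab hab', fun j hj => ?_⟩
      by_cases hjp : j.val < p
      · simpa [vertexOf, hjp] using hagree j hjp
      · obtain rfl : j = ⟨p, hpn⟩ := Fin.ext (by simp; omega)
        simpa [vertexOf] using ⟨ha', hb'⟩
  obtain ⟨a, b, hab, hagree⟩ := key n (NeZero.one_le) le_rfl
  rwa [funext fun j => (hagree j j.isLt).1, funext fun j => (hagree j j.isLt).2] at hab

theorem adjMatrix_eq_tensorProd {n : ℕ} {N : Fin n → ℕ} {G : SimpleGraph (Vertex N)}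
    [DecidableRel G.Adj] {r : ∀ j : Fin n, Fin (N j) → Fin (N j) → Prop}
    (h : ∀ u v, G.Adj u v ↔ ∀ j, r j (u j) (v j)) :
    G.adjMatrix ℂ = tensorProd fun j => relMatrix (r j) := by
  classical
  ext u v
  simp [tensorProd, relMatrix, SimpleGraph.adjMatrix_apply, h, Finset.prod_ite_zero]

/-- Degrees are row sums of `A`, and row sums of a tensor product factor. -/
theorem degMatrix_eq_tensorProd {n : ℕ} {N : Fin n → ℕ} {G : SimpleGraph (Vertex N)}
    [DecidableRel G.Adj] {r : ∀ j : Fin n, Fin (N j) → Fin (N j) → Prop}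
    (h : ∀ u v, G.Adj u v ↔ ∀ j, r j (u j) (v j)) :
    G.degMatrix ℂ = tensorProd fun j => relDegMatrix (r j) := by
  have hrow : ∀ u, (G.degree u : ℂ) = ∏ j, ∑ y, relMatrix (r j) (u j) y := fun u => by
    have h1 := G.adjMatrix_mulVec_const_apply (α := ℂ) (a := 1) (v := u)
    rw [mul_one, adjMatrix_eq_tensorProd h] at h1
    rw [Fintype.prod_sum, ← h1]
    simp [Matrix.mulVec, dotProduct, tensorProd]
  ext u v
  rw [SimpleGraph.degMatrix, Matrix.diagonal_apply]
  simp only [tensorProd, relDegMatrix, Matrix.of_apply, Matrix.diagonal_apply]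
  rw [Finset.prod_ite_zero, hrow]
  simp [funext_iff]

theorem trace_signlessLaplacian {V : Type*} [Fintype V] [DecidableEq V] (G : SimpleGraph V)
    [DecidableRel G.Adj] : (signlessLaplacian G).trace = ((∑ v, G.degree v : ℕ) : ℂ) := by
  simp [signlessLaplacian, Matrix.trace_add, SimpleGraph.degMatrix, Matrix.trace_diagonal]

end GraphState

theorem theorem4 {n : ℕ} [NeZero n] (N : Fin n → ℕ)
    (G : SimpleGraph (GraphState.Vertex N)) [DecidableRel G.Adj]
    (hne : ∃ u v : GraphState.Vertex N, G.Adj u v)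
    (hsymm : GraphState.IsPartiallySymmetric G)
    (hlayer : ∀ u v : GraphState.Vertex N, u 0 = v 0 → ¬ G.Adj u v)
    (hblock : GraphState.EqualInterlayerBlocks G)
    (hdeg : ∀ u v : GraphState.Vertex N, u 0 = v 0 → G.degree u = G.degree v) :
    GraphState.IsFullySeparable (GraphState.rhoQ G) := by
  obtain ⟨u, v, huv⟩ := hne
  have : ∀ j, Nonempty (Fin (N j)) := fun j => ⟨u j⟩
  have hprod := GraphState.adj_iff_forall_coordRel hlayer hblock
  have hpos : ∑ w, G.degree w ≠ 0 := fun h0 => by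
    have h1 := (Finset.sum_eq_zero_iff.1 h0) u (Finset.mem_univ u)
    exact ((G.degree_pos_iff_exists_adj u).2 ⟨v, huv⟩).ne' h1
  have htr := GraphState.trace_signlessLaplacian G
  have htr0 : (GraphState.signlessLaplacian G).trace ≠ 0 := by
    rw [htr]
    exact_mod_cast hpos
  refine GraphState.isFullySeparable_of_eq_sum (ι := Fin n → ℤˣ) ?_
    (fun s => ((∑ w, G.degree w : ℕ) : ℝ)⁻¹ * ((1 + ∏ j, ((s j : ℤ) : ℝ)) / 2 ^ n))
    (fun s j => GraphState.relDegMatrix (GraphState.coordRel G j) +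
      ((s j : ℤ) : ℂ) • GraphState.relMatrix (GraphState.coordRel G j)) (fun s => ?_)
    (fun s j => GraphState.posSemidef_relDegMatrix_add_smul
      (GraphState.coordRel_symmetric G j) (s j)) ?_
  · rw [GraphState.rhoQ, Matrix.trace_smul, smul_eq_mul, inv_mul_cancel₀ htr0]
  -- The product of signs is `±1`, so this is 0 or 2.
  · have hs : (0 : ℝ) ≤ 1 + ∏ j, ((s j : ℤ) : ℝ) := by
      have h1 : ∏ j, ((s j : ℤ) : ℝ) = (((∏ j, s j : ℤˣ) : ℤ) : ℝ) := by
        push_cast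
        rfl
      rw [h1]
      rcases Int.units_eq_one_or (∏ j, s j) with h | h <;> rw [h] <;> norm_num
    positivity
  · rw [GraphState.rhoQ, htr, GraphState.signlessLaplacian,
      GraphState.degMatrix_eq_tensorProd hprod, GraphState.adjMatrix_eq_tensorProd hprod,
      GraphState.tensorProd_add_tensorProd, Finset.smul_sum]
    refine Finset.sum_congr rfl fun s _ => ?_
    rw [smul_smul]
    push_cast
    rfl
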